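/- All codes are over $F=\mathrm{GF}(2)$; positions of words of length $n$ are $I=\{0,\dots,n-1\}$, taken modulo $n$. For $a,b\in I$ let $[a,b]=\{a,\dots,b\}$ if $a\le b$ and $[a,b]=\{a,\dots,n-1,0,\dots,b\}$ if $a>b$, and let $(a,b]=[a,b]\setminus\{a\}$. We say that $(a,b]$ is a span of a word $x$ if $[a,b]$ contains all nonzero positions of $x$ and $x_a\neq 0\neq x_b$. A characteristic matrix, with span list $T=\{(a_l,b_l]: 1\le l\le n\}$, of a $\kappa$-dimensional code $C\subseteq F^n$ with full support is an $n\times n$ matrix with rows $x_1,\dots,x_n$ such that: the rows generate $C$; $(a_l,b_l]$ is a span of $x_l$ for every $l$; $a_1,\dots,a_n$ are distinct and $b_1,\dots,b_n$ are distinct; every $j\in I$ lies in exactly $n-\kappa$ of the spans $(a_l,b_l]$. Let $G(D)=\sum_i G_iD^i$ be a canonical (that is, basic and reduced) polynomial generator matrix of size $k_0\times n_0$ over $F$, with a canonical polynomial check matrix $H(D)$ of size $(n_0-k_0)\times n_0$, $G(D)H(D)^{T}=0$. Let $L$ and $M$ be the largest degrees of entries of $G(D)$ and $H(D)$, let $N\ge\max(L,M)+1$,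 and put $n=n_0N$, $k=k_0N$. Let $G_N^{tb}$ be the $k\times n$ block-circulant tail-biting generator matrix whose $k_0\times n_0$ block in position $(s,t)$, $0\le s,t<N$, is $G_{(t-s)\bmod N}$ (with $G_i=0$ for $i>L$), and let $C\subseteq F^n$ be the code generated by $G_N^{tb}$, with dual code $C^\perp$. Proposition A.1. Let $X$ be a characteristic matrix of $C$ with span list $T$ and $Y$ a characteristic matrix of $C^\perp$ with span list $\hat T$. Let $\tilde X$ consist of $k$ rows of $X$ and $\tilde Y$ of $n-k$ rows of $Y$, and let $S\subseteq T$ and $\hat S\subseteq\hat T$ be the corresponding sets of spans. Assume: (i) $\tilde X$ consists of $k_0$ rows and their right cyclic shifts by $in_0$ positions, $0\le i<N$; (ii) no span in $S$ includes a span in $T$ other than itself; (iii) the rows of $\tilde Y$ are linearly independent; (iv) $\tilde Y$ consists of $n_0-k_0$ rows and their right cyclic shifts by $in_0$ positions, $0\le i<N$; (v) no span in $\hat S$ includes a span in $\hat T$ other than itself; (vi) for every $(b,a]\in\hat T$: $(b,a]\in\hat S$ if and only if $(a,b]\notin S$. Then the rows of $\tilde X$ are linearly independent (so $\tilde X$ has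 rank $k$) and generate $C$; that is, $\tilde X$ is equivalent to $G_N^{tb}$. -/

import Mathlib

open scoped Polynomial

/-- The binary field `GF(2)`. -/
abbrev F2 : Type := ZMod 2

/-! ### Intervals and spans on the cyclic time axis `{0, …, n-1}` -/

/-- The closed cyclic interval `[a, b]`: `{a, …, b}` if `a ≤ b`, and
`{a, …, n-1, 0, …, b}` if `a > b`. -/
def cycIcc {n : ℕ} (a b : Fin n) : Set (Fin n) :=
  {i | if a ≤ b then a ≤ i ∧ i ≤ b else a ≤ i ∨ i ≤ b}

/-- The semiopen cyclic interval `(a, b] = [a, b] \ {a}`. -/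
def cycIoc {n : ℕ} (a b : Fin n) : Set (Fin n) :=
  cycIcc a b \ {a}

/-- `s = (a, b]`, recorded as the pair of its end points, is a span of the word `x` in the sense of
characteristic generators: `[a, b]` contains all nonzero positions of `x`, and the end points
`x_a`, `x_b` are nonzero. -/
def IsSpanOf {n : ℕ} (s : Fin n × Fin n) (x : Fin n → F2) : Prop :=
  (∀ i, x i ≠ 0 → i ∈ cycIcc s.1 s.2) ∧ x s.1 ≠ 0 ∧ x s.2 ≠ 0

/-- Cyclic shift of a word to the right by `j` positions (indices modulo `n`). -/
def cycShiftRight {n : ℕ} (j : ℕ) (x : Fin n → F2) : Fin n → F2 :=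
  fun i => x (((finRotate n) ^ j).symm i)

/-! ### Linear block codes and characteristic matrices -/

/-- The dual code `C^⊥` with respect to the standard bilinear form. -/
def dualCode {n : ℕ} (C : Submodule F2 (Fin n → F2)) : Submodule F2 (Fin n → F2) where
  carrier := {y | ∀ x ∈ C, x ⬝ᵥ y = 0}
  zero_mem' := fun x _ => dotProduct_zero x
  add_mem' := fun {y z} hy hz x hx => by
    rw [dotProduct_add, hy x hx, hz x hx, add_zero]
  smul_mem' := fun c y hy x hx => by
    rw [dotProduct_smul, hy x hx, smul_zero]

open Classical in
/-- `X`, with rows `x_l`, is a characteristic matrix for the code `C` with characteristic span list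
`T = {(a_l, b_l]}`. -/
structure IsCharacteristicMatrix {n : ℕ} (C : Submodule F2 (Fin n → F2))
    (X : Matrix (Fin n) (Fin n) F2) (T : Fin n → Fin n × Fin n) : Prop where
  /-- `C` has full support. -/
  full_support : ∀ i, ∃ x ∈ C, x i ≠ 0
  /-- The rows generate `C`. -/
  span_rows : Submodule.span F2 (Set.range fun l => X l) = C
  /-- `(a_l, b_l]` is a span of `x_l`. -/
  isSpanOf : ∀ l, IsSpanOf (T l) (X l)
  /-- The starting points are distinct. -/
  start_injective : Function.Injective fun l => (T l).1
  /-- The end points are distinct. -/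
  end_injective : Function.Injective fun l => (T l).2
  /-- Every `j` lies in exactly `n - k` of the spans, `k` being the dimension of `C`. -/
  card_cover : ∀ j, (Finset.univ.filter fun l => j ∈ cycIoc (T l).1 (T l).2).card
    = n - Module.finrank F2 C

/-- The set of spans attached to the rows with index in `A`. -/
def spanSet {n : ℕ} (T : Fin n → Fin n × Fin n) (A : Finset (Fin n)) : Set (Fin n × Fin n) :=
  T '' (A : Set (Fin n))

/-- No span attached to a row in `A` includes any span of the list `T` except itself. -/
def NoProperInclusion {n : ℕ} (T : Fin n → Fin n × Fin n) (A : Finset (Fin n)) : Prop :=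
  ∀ s ∈ spanSet T A, ∀ t ∈ Set.range T, cycIoc t.1 t.2 ⊆ cycIoc s.1 s.2 → t = s

/-- The rows of `X` with index in `A` are `m` rows together with their right cyclic shifts by
`0, p, 2p, …, (N-1)p` positions (counted with multiplicity, in some order). -/
def IsShiftGenerated {n : ℕ} (X : Matrix (Fin n) (Fin n) F2) (A : Finset (Fin n))
    (m N p : ℕ) : Prop :=
  ∃ (r : Fin m → Fin n → F2) (e : Fin m × Fin N ≃ {l // l ∈ A}),
    ∀ t i, X (e (t, i)).1 = cycShiftRight ((i : ℕ) * p) (r t)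

/-! ### Polynomial generator matrices and tail-biting convolutional codes -/

/-- The degree of the `i`-th row of a polynomial matrix. -/
def rowDegree {k n : ℕ} (G : Matrix (Fin k) (Fin n) F2[X]) (i : Fin k) : ℕ :=
  Finset.univ.sup fun j => (G i j).natDegree

/-- The memory length of a polynomial matrix: the largest degree of an entry. -/
def memoryLength {k n : ℕ} (G : Matrix (Fin k) (Fin n) F2[X]) : ℕ :=
  Finset.univ.sup fun i => rowDegree G i

/-- A polynomial matrix is canonical if it is basic (it has a polynomial right inverse) and reduced
(the matrix of leading coefficients of its rows has linearly independent rows). -/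
def IsCanonical {k n : ℕ} (G : Matrix (Fin k) (Fin n) F2[X]) : Prop :=
  (∃ K : Matrix (Fin n) (Fin k) F2[X], G * K = 1) ∧
    LinearIndependent F2 fun i : Fin k => fun j : Fin n => (G i j).coeff (rowDegree G i)

/-- The tail-biting generator matrix with `N` sections: its blocks are `N × N` matrices of size
`k × n`, the block in position `(s, t)` being the coefficient `G_{(t - s) mod N}` of `G(D)`. -/
def tbgm {k n : ℕ} (G : Matrix (Fin k) (Fin n) F2[X]) (N : ℕ) :
    Matrix (Fin N × Fin k) (Fin (N * n)) F2 :=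
  fun s c => (G s.2 (finProdFinEquiv.symm c).2).coeff
    (((finProdFinEquiv.symm c).1 - s.1 : Fin N) : ℕ)

/-- The tail-biting convolutional code of section length `N` defined by `G(D)`: the block code of
length `N * n` generated by the tail-biting generator matrix. -/
def tbCode {k n : ℕ} (G : Matrix (Fin k) (Fin n) F2[X]) (N : ℕ) :
    Submodule F2 (Fin (N * n) → F2) :=
  Submodule.span F2 (Set.range fun s => tbgm G N s)

/-! Suppose `∑ c_l x_l = 0` over the selected rows. Cut the circle at `j`, and let `w` collect, from
each selected row whose span contains `j`, the part from its start up to the cut, weighted by `c_l`.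

Complementarity says that the reversal of a selected span of `C` is an unselected span of the dual,
hence lies in no selected dual span. This controls the products of partial words and makes `w`
orthogonal to every selected dual row (`sum_tailFrom_mem`). Those rows generate the dual, so `w ∈
C`.

If some `c_l ≠ 0`, choose `j` in its span. The contributing row with the earliest start `a` makes
`w` start at `a` and stop before `j`, although its characteristic span reaches `j`. No word of `C`
does that (`IsCharacteristicMatrix.exists_le_cutPos`). Hence the selected rows are independent, and
`finrank_tbCode` gives `dim C = N * k₀`, so they generate `C`. -/

/-! ### Cyclic intervals seen from a cut of the time axis -/

/-- The position of `i` on the time axis cut open just before `j`. -/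
def cutPos {n : ℕ} (j i : Fin n) : ℕ := ((i - j : Fin n) : ℕ)

theorem cutPos_eq {n : ℕ} (j i : Fin n) :
    cutPos j i = if (j : ℕ) ≤ i then (i : ℕ) - j else n + i - j := by
  have hi := i.2
  have hj := j.2
  unfold cutPos
  rw [Fin.sub_def]
  split_ifs with h
  · have : n - (j : ℕ) + i = n + (i - j) := by omega
    simp only [this, Nat.add_mod_left]
    exact Nat.mod_eq_of_lt (by omega)
  · simp only
    rw [Nat.mod_eq_of_lt (by omega)]
    omega

theorem cutPos_injective {n : ℕ} (j : Fin n) : Function.Injective (cutPos j) := by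
  intro i i' h
  have hi := i.2
  have hi' := i'.2
  have hj := j.2
  rw [cutPos_eq, cutPos_eq] at h
  apply Fin.ext
  split_ifs at h <;> omega

/-- Cyclic order does not depend on the cut, so `j` can be chosen to suit each argument and the rest
is linear arithmetic. -/
theorem mem_cycIcc_iff {n : ℕ} (j a b i : Fin n) :
    i ∈ cycIcc a b ↔ if cutPos j a ≤ cutPos j b then cutPos j a ≤ cutPos j i ∧
      cutPos j i ≤ cutPos j b else cutPos j a ≤ cutPos j i ∨ cutPos j i ≤ cutPos j b := by
  have hi := i.2
  have ha := a.2
  have hb := b.2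
  have hj := j.2
  simp only [cycIcc, Set.mem_ofPred_eq, Fin.le_def, cutPos_eq]
  by_cases h1 : (j : ℕ) ≤ a <;> by_cases h2 : (j : ℕ) ≤ b <;> by_cases h3 : (j : ℕ) ≤ i <;>
    simp only [h1, h2, h3, if_true, if_false] <;> split_ifs <;> omega

theorem mem_cycIoc_iff {n : ℕ} (j a b i : Fin n) :
    i ∈ cycIoc a b ↔ if cutPos j a ≤ cutPos j b then cutPos j a < cutPos j i ∧
      cutPos j i ≤ cutPos j b else cutPos j a < cutPos j i ∨ cutPos j i ≤ cutPos j b := by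
  have h : i ∈ ({a} : Set (Fin n)) ↔ cutPos j i = cutPos j a :=
    ⟨fun h => by rw [Set.mem_singleton_iff.1 h], fun h => cutPos_injective j h⟩
  rw [cycIoc, Set.mem_sdiff, h, mem_cycIcc_iff j]
  split_ifs <;> omega

theorem cutPos_self {n : ℕ} (j : Fin n) : cutPos j j = 0 := by
  simp [cutPos_eq]

/-- `j` is in `(a, b]` exactly when that interval is cut apart at `j`. -/
theorem mem_cycIoc_iff_cutPos_lt {n : ℕ} (j a b : Fin n) :
    j ∈ cycIoc a b ↔ cutPos j b < cutPos j a := by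
  rw [mem_cycIoc_iff j, cutPos_self]
  split_ifs <;> omega

/-! ### Partial words and their inner products -/

/-- The part of the word `x` from position `a` on, on the time axis cut open before `j`. -/
def tailFrom {n : ℕ} (j a : Fin n) (x : Fin n → F2) : Fin n → F2 :=
  fun i => if cutPos j a ≤ cutPos j i then x i else 0

section InnerProducts

variable {n : ℕ} {a b c d : Fin n} {x y : Fin n → F2}

/-- Only `x` crosses the cut. The interval of `y` cannot bridge the gap from `b` to `a`, so it
misses either the head of `x` (the product is all of `x ⬝ᵥ y`) or its tail. -/
theorem tailFrom_dotProduct_eq_zero (hx : IsSpanOf (a, b) x) (hy : IsSpanOf (c, d) y)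
    (hxy : x ⬝ᵥ y = 0) (hinc : ¬ cycIoc b a ⊆ cycIoc c d) {j : Fin n}
    (hja : j ∈ cycIoc a b) (hjc : j ∉ cycIoc c d) : tailFrom j a x ⬝ᵥ y = 0 := by
  rw [mem_cycIoc_iff_cutPos_lt] at hja hjc
  have key : cutPos j b < cutPos j c ∨ cutPos j d < cutPos j a := by
    by_contra hcon
    refine hinc fun i hi => ?_
    rw [mem_cycIoc_iff j] at hi ⊢
    split_ifs at hi ⊢ <;> omega
  rcases key with h | h
  · rw [← hxy]
    refine Finset.sum_congr rfl fun i _ => ?_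
    simp only [tailFrom]
    split_ifs with hi
    · rfl
    · by_cases hxi : x i = 0
      · simp [hxi]
      by_cases hyi : y i = 0
      · simp [hyi]
      have h1 := (mem_cycIcc_iff j _ _ _).1 (hx.1 i hxi)
      have h2 := (mem_cycIcc_iff j _ _ _).1 (hy.1 i hyi)
      simp only at h1 h2
      split_ifs at h1 h2 <;> omega
  · refine Finset.sum_eq_zero fun i _ => ?_
    simp only [tailFrom]
    split_ifs with hi
    · by_cases hyi : y i = 0
      · simp [hyi]
      have h2 := (mem_cycIcc_iff j _ _ _).1 (hy.1 i hyi)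
      simp only at h2
      split_ifs at h2 <;> omega
    · simp

/-- The mirror case: only `y` crosses the cut, and `x` misses its head or its tail. -/
theorem dotProduct_tailFrom_eq_zero (hx : IsSpanOf (a, b) x) (hy : IsSpanOf (c, d) y)
    (hxy : x ⬝ᵥ y = 0) (hinc : ¬ cycIoc b a ⊆ cycIoc c d) {j : Fin n}
    (hja : j ∉ cycIoc a b) (hjc : j ∈ cycIoc c d) : x ⬝ᵥ tailFrom j c y = 0 := by
  rw [mem_cycIoc_iff_cutPos_lt] at hja hjc
  have key : cutPos j b < cutPos j c ∨ cutPos j d < cutPos j a := by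
    by_contra hcon
    refine hinc fun i hi => ?_
    rw [mem_cycIoc_iff j] at hi ⊢
    split_ifs at hi ⊢ <;> omega
  rcases key with h | h
  · refine Finset.sum_eq_zero fun i _ => ?_
    simp only [tailFrom]
    split_ifs with hi
    · by_cases hxi : x i = 0
      · simp [hxi]
      have h1 := (mem_cycIcc_iff j _ _ _).1 (hx.1 i hxi)
      simp only at h1
      split_ifs at h1 <;> omega
    · simp
  · rw [← hxy]
    refine Finset.sum_congr rfl fun i _ => ?_
    simp only [tailFrom]
    split_ifs with hi
    · rfl
    · by_cases hxi : x i = 0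
      · simp [hxi]
      by_cases hyi : y i = 0
      · simp [hyi]
      have h1 := (mem_cycIcc_iff j _ _ _).1 (hx.1 i hxi)
      have h2 := (mem_cycIcc_iff j _ _ _).1 (hy.1 i hyi)
      simp only at h1 h2
      split_ifs at h1 h2 <;> omega

/-- Both words cross the cut. Head meets only head and tail only tail, so truncating either word
leaves the same terms. -/
theorem tailFrom_dotProduct_eq_dotProduct_tailFrom (hx : IsSpanOf (a, b) x)
    (hy : IsSpanOf (c, d) y) (hinc : ¬ cycIoc b a ⊆ cycIoc c d) {j : Fin n}
    (hja : j ∈ cycIoc a b) (hjc : j ∈ cycIoc c d) :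
    tailFrom j a x ⬝ᵥ y = x ⬝ᵥ tailFrom j c y := by
  rw [mem_cycIoc_iff_cutPos_lt] at hja hjc
  have key : cutPos j b < cutPos j c ∧ cutPos j d < cutPos j a := by
    by_contra hcon
    refine hinc fun i hi => ?_
    rw [mem_cycIoc_iff j] at hi ⊢
    split_ifs at hi ⊢ <;> omega
  refine Finset.sum_congr rfl fun i _ => ?_
  by_cases hxi : x i = 0
  · simp [hxi, tailFrom]
  by_cases hyi : y i = 0
  · simp [hyi, tailFrom]
  have h1 := (mem_cycIcc_iff j _ _ _).1 (hx.1 i hxi)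
  have h2 := (mem_cycIcc_iff j _ _ _).1 (hy.1 i hyi)
  simp only at h1 h2
  have h3 : cutPos j a ≤ cutPos j i ↔ cutPos j c ≤ cutPos j i := by
    split_ifs at h1 h2 <;> omega
  simp only [tailFrom, h3]
  split_ifs <;> simp

end InnerProducts

/-! ### Dual codes -/

theorem dualCode_eq_orthogonal {n : ℕ} (C : Submodule F2 (Fin n → F2)) :
    dualCode C = LinearMap.BilinForm.orthogonal (dotProductBilin F2 F2) C := by
  ext y
  rfl

theorem dotProductBilin_nondegenerate (n : ℕ) :
    LinearMap.BilinForm.Nondegenerate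
      (dotProductBilin F2 F2 : LinearMap.BilinForm F2 (Fin n → F2)) := by
  refine ⟨fun x hx => ?_, fun y hy => ?_⟩
  · exact dotProduct_eq_zero x hx
  · exact dotProduct_eq_zero y fun x => by rw [dotProduct_comm]; exact hy x

theorem finrank_dualCode {n : ℕ} (C : Submodule F2 (Fin n → F2)) :
    Module.finrank F2 (dualCode C) = n - Module.finrank F2 C := by
  rw [dualCode_eq_orthogonal,
    LinearMap.BilinForm.finrank_orthogonal (dotProductBilin_nondegenerate n)]
  simp

theorem dualCode_dualCode {n : ℕ} (C : Submodule F2 (Fin n → F2)) :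
    dualCode (dualCode C) = C := by
  rw [dualCode_eq_orthogonal, dualCode_eq_orthogonal,
    LinearMap.BilinForm.orthogonal_orthogonal (dotProductBilin_nondegenerate n)]
  intro x y h
  exact (dotProduct_comm y x).trans h

/-- A code is cut out by any set of words generating its dual. -/
theorem mem_of_dotProduct_eq_zero {n : ℕ} {C : Submodule F2 (Fin n → F2)}
    {s : Set (Fin n → F2)} (hs : Submodule.span F2 s = dualCode C) {w : Fin n → F2}
    (hw : ∀ y ∈ s, w ⬝ᵥ y = 0) : w ∈ C := by
  rw [← dualCode_dualCode C]
  intro y hy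
  rw [← hs] at hy
  rw [dotProduct_comm]
  induction hy using Submodule.span_induction with
  | mem y hy => exact hw y hy
  | zero => exact dotProduct_zero w
  | add y z _ _ hy hz => rw [dotProduct_add, hy, hz, add_zero]
  | smul c y _ hy => rw [dotProduct_smul, hy, smul_zero]

/-! ### Words of a code and characteristic spans -/

/-- Serves the extremal arguments: the earliest start, or the latest end, among the active rows
cannot cancel. -/
theorem sum_smul_apply_ne_zero {ι : Type*} {n : ℕ} {s : Finset ι} {d : ι → F2}
    {X : ι → Fin n → F2} {m : ι} {p : Fin n} (hm : m ∈ s) (hd : d m ≠ 0) (hp : X m p ≠ 0)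
    (h : ∀ m' ∈ s, m' ≠ m → d m' ≠ 0 → X m' p = 0) : (∑ i ∈ s, d i • X i) p ≠ 0 := by
  rw [Finset.sum_apply, Finset.sum_eq_single_of_mem m hm]
  · exact mul_ne_zero hd hp
  · intro m' hm' hne
    by_cases hd' : d m' = 0
    · simp [hd']
    · simp [h m' hm' hne hd']

namespace IsCharacteristicMatrix

variable {n : ℕ} {C : Submodule F2 (Fin n → F2)} {X : Matrix (Fin n) (Fin n) F2}
  {T : Fin n → Fin n × Fin n}

theorem row_mem (hX : IsCharacteristicMatrix C X T) (l : Fin n) : X l ∈ C := by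
  rw [← hX.span_rows]
  exact Submodule.subset_span ⟨l, rfl⟩

/-- On a time axis on which the span of a row is an interval, so is the support of the row. -/
theorem cutPos_bounds (hX : IsCharacteristicMatrix C X T) {a m i : Fin n}
    (hm : a ∉ cycIoc (T m).1 (T m).2) (hi : X m i ≠ 0) :
    cutPos a (T m).1 ≤ cutPos a i ∧ cutPos a i ≤ cutPos a (T m).2 := by
  rw [mem_cycIoc_iff_cutPos_lt] at hm
  have := (mem_cycIcc_iff a _ _ _).1 ((hX.isSpanOf m).1 i hi)
  split_ifs at this with h
  · exact this
  · omega

open Classical in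
/-- The rows whose spans do not contain `a` form a basis of the code. -/
theorem linearIndepOn_notMem (hX : IsCharacteristicMatrix C X T) (a : Fin n) :
    LinearIndepOn F2 (fun l => X l)
      (↑(Finset.univ.filter fun l => a ∉ cycIoc (T l).1 (T l).2) : Set (Fin n)) := by
  rw [linearIndepOn_finset_iff]
  intro d hd
  by_contra! hcon
  obtain ⟨l, hl, hdl⟩ := hcon
  obtain ⟨m, hm, hmin⟩ := Finset.exists_min_image
    ((Finset.univ.filter fun l => a ∉ cycIoc (T l).1 (T l).2).filter fun l => d l ≠ 0)
    (fun l => cutPos a (T l).1) ⟨l, by simp_all⟩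
  rw [Finset.mem_filter] at hm
  refine sum_smul_apply_ne_zero (X := fun l => X l) hm.1 hm.2 (hX.isSpanOf m).2.1
    (fun m' hm' hne hd' => ?_) (congrFun hd (T m).1)
  by_contra h0
  have h1 := (hX.cutPos_bounds (Finset.mem_filter.1 hm').2 h0).1
  have h2 := hmin m' (Finset.mem_filter.2 ⟨hm', hd'⟩)
  exact hne (hX.start_injective (cutPos_injective a (le_antisymm h1 h2)))

open Classical in
-- By the covering count exactly `dim C` spans avoid `a`, so the independent rows are enough.
theorem span_notMem (hX : IsCharacteristicMatrix C X T) (a : Fin n) :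
    Submodule.span F2 ((fun l => X l) ''
      (↑(Finset.univ.filter fun l => a ∉ cycIoc (T l).1 (T l).2) : Set (Fin n))) = C := by
  apply Submodule.eq_of_le_of_finrank_eq
  · rw [Submodule.span_le]
    rintro _ ⟨l, _, rfl⟩
    exact hX.row_mem l
  · have h := finrank_span_eq_card (hX.linearIndepOn_notMem a)
    have hC : Module.finrank F2 C ≤ n := by simpa using Submodule.finrank_le C
    have h1 := Finset.card_filter_add_card_filter_not (s := (Finset.univ : Finset (Fin n)))
      (fun l => a ∈ cycIoc (T l).1 (T l).2)
    rw [hX.card_cover a, Finset.card_univ, Fintype.card_fin] at h1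
    rw [Set.image_eq_range]
    refine h.trans ?_
    simp only [Finset.coe_sort_coe, Fintype.card_coe]
    omega

/-- A word of the code that starts at `a` does not end before the characteristic span
starting at `a` does. -/
theorem exists_le_cutPos (hX : IsCharacteristicMatrix C X T) {l j : Fin n}
    (hj : j ∈ cycIoc (T l).1 (T l).2) {w : Fin n → F2} (hw : w ∈ C) (hwa : w (T l).1 ≠ 0) :
    ∃ i, w i ≠ 0 ∧ cutPos (T l).1 j ≤ cutPos (T l).1 i := by
  classical
  set a := (T l).1 with ha
  set M := Finset.univ.filter fun l => a ∉ cycIoc (T l).1 (T l).2 with hM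
  rw [← hX.span_notMem a, Submodule.mem_span_image_finset_iff_exists_fun'] at hw
  obtain ⟨d, rfl⟩ := hw
  have hlM : l ∈ M := by simp [hM, cycIoc, ← ha]
  -- Cut at `a`, every other row of the basis starts later, so only row `l` can contribute to `w a`.
  have hdl : d l ≠ 0 := by
    intro hd0
    rw [Finset.sum_apply] at hwa
    refine hwa (Finset.sum_eq_zero fun m hm => ?_)
    by_cases hml : m = l
    · simp [hml, hd0]
    · have : X m a = 0 := by
        by_contra h0
        have h1 := (hX.cutPos_bounds (Finset.mem_filter.1 hm).2 h0).1
        rw [cutPos_self] at h1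
        refine hml (hX.start_injective (cutPos_injective a ?_))
        change cutPos a (T m).1 = cutPos a (T l).1
        rw [← ha, cutPos_self]
        omega
      simp [this]
  obtain ⟨m, hm, hmax⟩ := Finset.exists_max_image (M.filter fun l => d l ≠ 0)
    (fun l => cutPos a (T l).2) ⟨l, by simp_all⟩
  rw [Finset.mem_filter] at hm
  refine ⟨(T m).2, ?_, ?_⟩
  · refine sum_smul_apply_ne_zero (X := fun l => X l) hm.1 hm.2 (hX.isSpanOf m).2.2
      fun m' hm' hne hd' => ?_
    by_contra h0
    have h1 := (hX.cutPos_bounds (Finset.mem_filter.1 hm').2 h0).2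
    have h2 := hmax m' (Finset.mem_filter.2 ⟨hm', hd'⟩)
    exact hne (hX.end_injective (cutPos_injective a (le_antisymm h2 h1)))
  · have h1 := hmax l (Finset.mem_filter.2 ⟨hlM, hdl⟩)
    have h2 := (mem_cycIoc_iff a _ _ _).1 hj
    rw [cutPos_self] at h2
    simp only [zero_le, if_true] at h2
    exact h2.2.trans h1

end IsCharacteristicMatrix

/-! ### The dimension of a tail-biting convolutional code -/

open Polynomial in
-- Block-circulant rows are the products `X ^ s * G i j` modulo `X ^ N - 1`, so a relation among
-- them is a polynomial vector `p` with `p * G ≡ 0`.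
theorem tbgm_polynomial_dvd {k n N : ℕ} (G : Matrix (Fin k) (Fin n) F2[X])
    (hN : memoryLength G < N) (c : Fin N × Fin k → F2)
    (hc : ∑ s, c s • tbgm G N s = 0) (j : Fin n) :
    (X ^ N - 1 : F2[X]) ∣ ∑ i, (∑ s : Fin N, C (c (s, i)) * X ^ (s : ℕ)) * G i j := by
  have : NeZero N := ⟨by omega⟩
  have hroot : AdjoinRoot.root (X ^ N - 1 : F2[X]) ^ N = 1 := by
    have := AdjoinRoot.eval₂_root (X ^ N - 1 : F2[X])
    simpa [sub_eq_zero] using this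
  set θ := AdjoinRoot.root (X ^ N - 1 : F2[X]) with hθ
  have hdeg : ∀ i, (G i j).natDegree < N := fun i =>
    lt_of_le_of_lt ((Finset.le_sup (f := fun j => (G i j).natDegree) (Finset.mem_univ j)).trans
      (Finset.le_sup (f := fun i => rowDegree G i) (Finset.mem_univ i))) hN
  -- Degrees below `N` keep distinct coefficients of `G i j` from being folded together; `θ ^ N = 1`
  -- turns multiplication by `θ ^ s` into a cyclic shift.
  have hG : ∀ i (s : Fin N), θ ^ (s : ℕ) * AdjoinRoot.mk (X ^ N - 1) (G i j) =
      ∑ t : Fin N, (G i j).coeff ((t - s : Fin N) : ℕ) • θ ^ (t : ℕ) := by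
    intro i s
    rw [← AdjoinRoot.aeval_eq, aeval_eq_sum_range' (hdeg i), Finset.mul_sum,
      Finset.sum_range, ← Equiv.sum_comp (Equiv.subRight s)]
    refine Finset.sum_congr rfl fun t _ => ?_
    rw [Equiv.subRight_apply, mul_smul_comm, ← pow_add]
    congr 1
    have h : (t : ℕ) = (s + ((t - s : Fin N) : ℕ)) % N := by
      rw [← Fin.val_add, add_sub_cancel]
    rw [h, ← pow_eq_pow_mod _ hroot]
  rw [← AdjoinRoot.mk_eq_zero]
  simp only [map_sum, map_mul, map_pow, AdjoinRoot.mk_X, AdjoinRoot.mk_C, Finset.sum_mul, ← hθ,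
    mul_assoc, hG]
  have hcol : ∀ t : Fin N, ∑ i, ∑ s : Fin N,
      c (s, i) * (G i j).coeff ((t - s : Fin N) : ℕ) = 0 := by
    intro t
    have := congrFun hc (finProdFinEquiv (t, j))
    rw [Finset.sum_apply, Fintype.sum_prod_type_right] at this
    simpa [tbgm] using this
  calc _ = ∑ t : Fin N, (∑ i, ∑ s : Fin N,
        c (s, i) * (G i j).coeff ((t - s : Fin N) : ℕ)) • θ ^ (t : ℕ) := by
        simp only [Finset.sum_smul, Finset.mul_sum]
        rw [Finset.sum_comm (s := (Finset.univ : Finset (Fin N)))]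
        refine Finset.sum_congr rfl fun i _ => ?_
        rw [Finset.sum_comm]
        refine Finset.sum_congr rfl fun t _ => Finset.sum_congr rfl fun s _ => ?_
        rw [mul_smul, Algebra.smul_def (c (s, i))]
        rfl
    _ = 0 := by simp [hcol]

open Polynomial in
-- The right inverse gives `p = p * G * K`, divisible by `X ^ N - 1`, while each entry of `p` has
-- degree below `N`.
theorem linearIndependent_tbgm {k n N : ℕ} (G : Matrix (Fin k) (Fin n) F2[X])
    {K : Matrix (Fin n) (Fin k) F2[X]} (hK : G * K = 1) (hN : memoryLength G < N) :
    LinearIndependent F2 fun s => tbgm G N s := by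
  rw [Fintype.linearIndependent_iff]
  rintro c hc ⟨s, i⟩
  set p : Fin k → F2[X] := fun i => ∑ s : Fin N, C (c (s, i)) * X ^ (s : ℕ) with hp
  have hdvd : (X ^ N - 1 : F2[X]) ∣ p i := by
    have h : p = Matrix.vecMul (Matrix.vecMul p G) K := by
      rw [Matrix.vecMul_vecMul, hK, Matrix.vecMul_one]
    rw [h, Matrix.vecMul, dotProduct]
    exact Finset.dvd_sum fun j _ =>
      Dvd.dvd.mul_right (b := Matrix.vecMul p G j) (tbgm_polynomial_dvd G hN c hc j) (K j i)
  have hdeg : (p i).degree < (X ^ N - 1 : F2[X]).degree := by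
    rw [← C_1, degree_X_pow_sub_C (by omega)]
    refine (degree_sum_le _ _).trans_lt ((Finset.sup_lt_iff (WithBot.bot_lt_coe N)).2
      fun s _ => (degree_C_mul_X_pow_le _ _).trans_lt ?_)
    exact Nat.cast_lt.2 s.2
  have h0 := eq_zero_of_dvd_of_degree_lt hdvd hdeg
  have h1 : (p i).coeff s = c (s, i) := by
    simp [hp, coeff_C_mul, coeff_X_pow, Fin.val_inj]
  rw [← h1, h0, coeff_zero]

theorem finrank_tbCode {k n N : ℕ} {G : Matrix (Fin k) (Fin n) F2[X]} (hG : IsCanonical G)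
    (hN : memoryLength G < N) : Module.finrank F2 (tbCode G N) = N * k := by
  obtain ⟨⟨K, hK⟩, -⟩ := hG
  rw [tbCode, finrank_span_eq_card (linearIndependent_tbgm G hK hN)]
  simp

/-! ### Complementary selections of characteristic spans -/

/-- The spans selected by `A` are the reversals of the spans not selected by `B`, so none of their
reversals is included in a span selected by `B`. -/
theorem not_cycIoc_subset_of_complementary {n : ℕ} {T U : Fin n → Fin n × Fin n}
    {A B : Finset (Fin n)} (hU : Function.Injective fun l => (U l).1) (hAB : A.card + B.card = n)
    (hv : NoProperInclusion U B)
    (hvi : ∀ a b, (b, a) ∈ Set.range U → ((b, a) ∈ spanSet U B ↔ (a, b) ∉ spanSet T A))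
    {l m : Fin n} (hl : l ∈ A) (hm : m ∈ B) :
    ¬ cycIoc (T l).2 (T l).1 ⊆ cycIoc (U m).1 (U m).2 := by
  classical
  have hUinj : Function.Injective U := fun l m h => hU (congrArg Prod.fst h)
  have hnot : ∀ m ∉ B, U m ∉ spanSet U B := by
    rintro m hm ⟨m', hm', h⟩
    exact hm (hUinj h ▸ hm')
  have himg : Bᶜ.image (fun m => (U m).swap) ⊆ A.image T := by
    intro s hs
    obtain ⟨m, hm, rfl⟩ := Finset.mem_image.1 hs
    have h := hvi (U m).2 (U m).1 ⟨m, rfl⟩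
    have h' : (U m).swap ∈ spanSet T A := by
      by_contra hcon
      exact hnot m (Finset.mem_compl.1 hm) (h.2 hcon)
    obtain ⟨l, hl, hlm⟩ := h'
    exact Finset.mem_image.2 ⟨l, hl, hlm⟩
  -- Counting upgrades the inclusion to equality: the selected spans are exactly the reversals of
  -- the unselected dual ones.
  have hcard : (A.image T).card ≤ (Bᶜ.image fun m => (U m).swap).card := by
    rw [Finset.card_image_of_injective _ fun _ _ h => hUinj (Prod.swap_injective h), Finset.card_compl,
      Fintype.card_fin]
    exact Finset.card_image_le.trans (by omega)
  have hTl : T l ∈ Bᶜ.image fun m => (U m).swap := by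
    rw [Finset.eq_of_subset_of_card_le himg hcard]
    exact Finset.mem_image_of_mem T hl
  obtain ⟨m', hm', h'⟩ := Finset.mem_image.1 hTl
  rw [← h']
  intro hsub
  have := hv (U m) ⟨m, hm, rfl⟩ (U m') ⟨m', rfl⟩ hsub
  exact hnot m' (Finset.mem_compl.1 hm') ⟨m, hm, this.symm⟩

theorem sum_smul_dotProduct {n : ℕ} {ι : Type*} (s : Finset ι) (c : ι → F2)
    (x : ι → Fin n → F2) (y : Fin n → F2) :
    (∑ l ∈ s, c l • x l) ⬝ᵥ y = ∑ l ∈ s, c l * (x l ⬝ᵥ y) := by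
  simp only [sum_dotProduct, smul_dotProduct, smul_eq_mul]

section Complementary

variable {n : ℕ} {C : Submodule F2 (Fin n → F2)} {X Y : Matrix (Fin n) (Fin n) F2}
  {T U : Fin n → Fin n × Fin n} {A B : Finset (Fin n)}

open Classical in
/-- If a combination of the selected rows vanishes, then its part before `j`, which involves only
the rows whose spans contain `j`, is in the code. -/
theorem sum_tailFrom_mem (hX : IsCharacteristicMatrix C X T)
    (hY : IsCharacteristicMatrix (dualCode C) Y U)
    (hspan : Submodule.span F2 ((fun m => Y m) '' (B : Set (Fin n))) = dualCode C)
    (hinc : ∀ l ∈ A, ∀ m ∈ B, ¬ cycIoc (T l).2 (T l).1 ⊆ cycIoc (U m).1 (U m).2)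
    {c : Fin n → F2} (hc : ∑ l ∈ A, c l • X l = 0) (j : Fin n) :
    ∑ l ∈ A.filter (fun l => j ∈ cycIoc (T l).1 (T l).2),
      c l • tailFrom j (T l).1 (X l) ∈ C := by
  refine mem_of_dotProduct_eq_zero hspan ?_
  rintro _ ⟨m, hm, rfl⟩
  have horth : ∀ l, X l ⬝ᵥ Y m = 0 := fun l => hY.row_mem m _ (hX.row_mem l)
  rw [sum_smul_dotProduct]
  by_cases hj : j ∈ cycIoc (U m).1 (U m).2
  -- Truncation moves from the rows to `Y m`; rows not crossing the cut then add zero, which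
  -- completes the sum to the vanishing combination.
  · have h0 : ∑ l ∈ A, c l * (X l ⬝ᵥ tailFrom j (U m).1 (Y m)) = 0 := by
      rw [← sum_smul_dotProduct A c (fun l => X l), hc, zero_dotProduct]
    rw [← h0, Finset.sum_filter]
    refine Finset.sum_congr rfl fun l hl => ?_
    split_ifs with hjl
    · rw [tailFrom_dotProduct_eq_dotProduct_tailFrom (hX.isSpanOf l) (hY.isSpanOf m)
        (hinc l hl m hm) hjl hj]
    · rw [dotProduct_tailFrom_eq_zero (hX.isSpanOf l) (hY.isSpanOf m) (horth l)
        (hinc l hl m hm) hjl hj, mul_zero]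
  · refine Finset.sum_eq_zero fun l hl => ?_
    rw [Finset.mem_filter] at hl
    rw [tailFrom_dotProduct_eq_zero (hX.isSpanOf l) (hY.isSpanOf m) (horth l)
      (hinc l hl.1 m hm) hl.2 hj, mul_zero]

/-- The starting point of a characteristic span differs from its end point, provided the dual code
has full support. -/
theorem IsCharacteristicMatrix.start_ne_end (hX : IsCharacteristicMatrix C X T)
    (hsupp : ∀ i, ∃ y ∈ dualCode C, y i ≠ 0) (l : Fin n) : (T l).1 ≠ (T l).2 := by
  intro h
  obtain ⟨y, hy, hyi⟩ := hsupp (T l).1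
  have h0 := hy _ (hX.row_mem l)
  rw [dotProduct, Finset.sum_eq_single_of_mem (T l).1 (Finset.mem_univ _)] at h0
  · exact mul_ne_zero (hX.isSpanOf l).2.1 hyi h0
  · intro i _ hi
    have : X l i = 0 := by
      by_contra hne
      have h1 := (hX.isSpanOf l).1 i hne
      rw [← h] at h1
      simp only [cycIcc, Set.mem_ofPred_eq, le_refl, if_true] at h1
      exact hi (le_antisymm h1.2 h1.1)
    rw [this, zero_mul]

theorem linearIndepOn_of_complementary (hX : IsCharacteristicMatrix C X T)
    (hY : IsCharacteristicMatrix (dualCode C) Y U)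
    (hspan : Submodule.span F2 ((fun m => Y m) '' (B : Set (Fin n))) = dualCode C)
    (hinc : ∀ l ∈ A, ∀ m ∈ B, ¬ cycIoc (T l).2 (T l).1 ⊆ cycIoc (U m).1 (U m).2) :
    LinearIndepOn F2 (fun l => X l) (A : Set (Fin n)) := by
  classical
  rw [linearIndepOn_finset_iff]
  intro c hc
  by_contra! hcon
  obtain ⟨l₀, hl₀, hcl₀⟩ := hcon
  -- Any point of the semiopen span would do; it is nonempty because start and end differ.
  set j := (T l₀).2 with hj
  have hjl₀ : j ∈ cycIoc (T l₀).1 (T l₀).2 := by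
    have hne : cutPos (T l₀).1 j ≠ cutPos (T l₀).1 (T l₀).1 := fun h =>
      hX.start_ne_end hY.full_support l₀ (cutPos_injective _ h).symm
    rw [cutPos_self] at hne
    rw [mem_cycIoc_iff (T l₀).1, cutPos_self, ← hj, if_pos (Nat.zero_le _)]
    omega
  obtain ⟨l, hl, hmin⟩ := Finset.exists_min_image
    ((A.filter fun l => j ∈ cycIoc (T l).1 (T l).2).filter fun l => c l ≠ 0)
    (fun l => cutPos j (T l).1)
    ⟨l₀, Finset.mem_filter.2 ⟨Finset.mem_filter.2 ⟨hl₀, hjl₀⟩, hcl₀⟩⟩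
  obtain ⟨hlA, hcl⟩ := Finset.mem_filter.1 hl
  have hlj := (Finset.mem_filter.1 hlA).2
  have hmem := sum_tailFrom_mem hX hY hspan hinc hc j
  obtain ⟨i, hi, hle⟩ := hX.exists_le_cutPos hlj hmem (by
    refine sum_smul_apply_ne_zero (X := fun l => tailFrom j (T l).1 (X l)) hlA hcl ?_
      fun m hm hne hcm => ?_
    · simpa [tailFrom] using (hX.isSpanOf l).2.1
    · refine if_neg fun h => hne ?_
      have := hmin m (Finset.mem_filter.2 ⟨hm, hcm⟩)
      exact hX.start_injective (cutPos_injective j (le_antisymm h this)))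
  refine hi ?_
  rw [Finset.sum_apply]
  refine Finset.sum_eq_zero fun m hm => ?_
  by_cases hcm : c m = 0
  · simp [hcm]
  have h1 := hmin m (Finset.mem_filter.2 ⟨hm, hcm⟩)
  -- Being at or after `j` when cut at the start of row `l` means being before that start when cut
  -- at `j`; there all the tails vanish.
  have h2 : ¬ cutPos j (T m).1 ≤ cutPos j i := by
    have := (T l).1.2
    have := j.2
    have := i.2
    have := (mem_cycIoc_iff_cutPos_lt _ _ _).1 hlj
    simp only [cutPos_eq] at h1 hle this ⊢
    split_ifs at * <;> omega
  simp [tailFrom, h2]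

end Complementary

theorem propositionA1 (k₀ n₀ N : ℕ)
    (G : Matrix (Fin k₀) (Fin n₀) F2[X]) (H : Matrix (Fin (n₀ - k₀)) (Fin n₀) F2[X])
    (hG : IsCanonical G) (hH : IsCanonical H) (hGH : G * H.transpose = 0)
    (hN : max (memoryLength G) (memoryLength H) + 1 ≤ N)
    (X : Matrix (Fin (N * n₀)) (Fin (N * n₀)) F2) (T : Fin (N * n₀) → Fin (N * n₀) × Fin (N * n₀))
    (hX : IsCharacteristicMatrix (tbCode G N) X T)
    (Y : Matrix (Fin (N * n₀)) (Fin (N * n₀)) F2) (U : Fin (N * n₀) → Fin (N * n₀) × Fin (N * n₀))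
    (hY : IsCharacteristicMatrix (dualCode (tbCode G N)) Y U)
    (A B : Finset (Fin (N * n₀)))
    (hA : A.card = N * k₀) (hB : B.card = N * n₀ - N * k₀)
    (hi : IsShiftGenerated X A k₀ N n₀)
    (hii : NoProperInclusion T A)
    (hiii : LinearIndependent F2 fun l : {l // l ∈ B} => Y l.1)
    (hiv : IsShiftGenerated Y B (n₀ - k₀) N n₀)
    (hv : NoProperInclusion U B)
    (hvi : ∀ a b, (b, a) ∈ Set.range U → ((b, a) ∈ spanSet U B ↔ (a, b) ∉ spanSet T A)) :
    LinearIndependent F2 (fun l : {l // l ∈ A} => X l.1) ∧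
      (X.submatrix (fun l : {l // l ∈ A} => l.1) id).rank = N * k₀ ∧
      Submodule.span F2 (Set.range fun l : {l // l ∈ A} => X l.1) = tbCode G N := by
  -- This gives `N * k₀ ≤ N * n₀`, so the truncated subtraction in `hB` is exact.
  have hle := A.card_le_univ
  rw [Fintype.card_fin, hA] at hle
  have hdim : Module.finrank F2 (tbCode G N) = N * k₀ :=
    finrank_tbCode hG (by have := le_max_left (memoryLength G) (memoryLength H); omega)
  have hspan : Submodule.span F2 ((fun m => Y m) '' (B : Set (Fin (N * n₀)))) =
      dualCode (tbCode G N) := by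
    apply Submodule.eq_of_le_of_finrank_eq
    · rw [Submodule.span_le]
      rintro _ ⟨l, _, rfl⟩
      exact hY.row_mem l
    · rw [Set.image_eq_range, finrank_dualCode, hdim, ← hB]
      exact (finrank_span_eq_card hiii).trans (Fintype.card_coe B)
  have hind : LinearIndependent F2 (fun l : {l // l ∈ A} => X l.1) :=
    linearIndepOn_of_complementary hX hY hspan fun l hl m hm =>
      not_cycIoc_subset_of_complementary hY.start_injective (by omega) hv hvi hl hm
  refine ⟨hind, ?_, ?_⟩
  · rw [← hA, ← Fintype.card_coe A]
    exact LinearIndependent.rank_matrix hind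
  · apply Submodule.eq_of_le_of_finrank_eq
    · rw [Submodule.span_le]
      rintro _ ⟨l, rfl⟩
      exact hX.row_mem l
    · rw [finrank_span_eq_card hind, hdim, Fintype.card_coe, hA]
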